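/- Let $n\ge 0$ and write a permutation $\sigma$ of $\{1,\dots,n\}$ in one-line notation $\sigma=\sigma_1\sigma_2\cdots\sigma_n$. **Patterns.** $\sigma$ contains $3\text{-}\bar 1\text{-}42$ if there are $i<j<n$ with $\sigma_{j+1}<\sigma_i<\sigma_j$ such that no $l$ with $i<l<j$ satisfies $\sigma_l<\sigma_{j+1}$. It contains $31\text{-}\bar 4\text{-}2$ if there are $i$ and $j>i+1$ with $\sigma_{i+1}<\sigma_j<\sigma_i$ such that no $l$ with $i+1<l<j$ satisfies $\sigma_l>\sigma_i$. Let $S_n(3\text{-}\bar 1\text{-}42,\,31\text{-}\bar 4\text{-}2)$ be the set of permutations of $\{1,\dots,n\}$ containing neither. **Piles.** Extended Patience Sorting reads $\sigma_1,\sigma_2,\dots,\sigma_n$ in order and builds insertion piles $R(\sigma)=\{r_1,\dots,r_m\}$ and recording piles $S(\sigma)=\{s_1,\dots,s_m\}$, starting from no piles: if some pile has a top card larger than $\sigma_i$, put $\sigma_i$ on top of the left-most such pile $r_j$ and put $i$ at the bottom of $s_j$; otherwise start a new right-most pile consisting of $\sigma_i$ and a new right-most recording pile consisting of $i$. The bottom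 row of a pile configuration is the list of the bottom cards of its piles, from left to right. The reverse patience word $RPW(R)$ is obtained by reading the piles of $R$ from bottom to top, from left to right; a permutation of $\{1,\dots,n\}$ is called a reverse patience word if it equals $RPW(R(\tau))$ for some permutation $\tau$ of $\{1,\dots,n\}$. **Shadow diagram.** The shadow of $(a,b)\in\mathbb Z^2$ is $U(a,b)=\{(x,y)\in\mathbb R^2: x\le a,\ y\le b\}$, and the (southwest) shadowline of a finite set of lattice points is the boundary of the union of their shadows. The $0$th-iterate shadow diagram $D^{(0)}(\sigma)=\{L_1,L_2,\dots,L_k\}$ is formed as follows: as long as the set $A$ of those points $(i,\sigma_i)$, $1\le i\le n$, that lie on none of $L_1,\dots,L_j$ is nonempty, $L_{j+1}$ is the shadowline of those points of $A$ whose shadow contains no other point of $A$. It is non-intersecting if any two distinct shadowlines in it are disjoint. **Theorem.** $S_n(3\text{-}\bar 1\text{-}42,\,31\text{-}\bar 4\text{-}2)$ is exactly the set of reverse patience words $\sigma$ of $\{1,\dots,n\}$ whose $0$th-iterate shadow diagram $D^{(0)}(\sigma)$ is non-intersecting, i.e. no two of its shadowlines cross. Moreover, for every $\sigma\in S_n(3\text{-}\bar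 1\text{-}42,\,31\text{-}\bar 4\text{-}2)$, the bottom rows of $R(\sigma)$ and of $S(\sigma)$ both increase strictly from left to right. -/

import Mathlib

namespace PatienceSorting

/-! Permutations of `{1, …, n}` are elements of `Equiv.Perm (Fin n)`; positions and values are
shifted by one where the actual numbers `1, …, n` are used. -/

/-! ### Barred generalized patterns -/

/-- A barred generalized permutation pattern of length `len`: its letters in one-line notation,
which letters carry a bar, and after which letters a dash is written
(the entry of `dashAfter` at the last letter is not used). -/
structure BarredPattern where
  len : ℕ
  letter : Fin len → ℕ
  barred : Fin len → Bool
  dashAfter : Fin len → Bool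

/-- The positions `f a`, for `a ∈ T`, form an occurrence in `σ` of the letters of `β` whose
places belong to `T`: they increase, the entries of `σ` there are in the same relative order as
the letters of `β`, and entries are adjacent in `σ` if their letters are neighbours in `β` with no
dash in between. The values of `f` outside `T` are irrelevant. -/
def BarredPattern.OccursAt (β : BarredPattern) (T : Set (Fin β.len)) {n : ℕ}
    (σ : Equiv.Perm (Fin n)) (f : Fin β.len → Fin n) : Prop :=
  (∀ a ∈ T, ∀ b ∈ T, a < b → f a < f b) ∧
  (∀ a ∈ T, ∀ b ∈ T, σ (f a) < σ (f b) ↔ β.letter a < β.letter b) ∧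
  (∀ a ∈ T, ∀ b ∈ T, (b : ℕ) = a + 1 → β.dashAfter a = false → (f b : ℕ) = f a + 1)

/-- `σ` contains the barred pattern `β`: some occurrence of the unbarred letters of `β` cannot be
completed, by entries of `σ` playing the roles of the barred letters, to an occurrence of the
whole pattern with the bars removed. -/
def BarredPattern.ContainedIn (β : BarredPattern) {n : ℕ} (σ : Equiv.Perm (Fin n)) : Prop :=
  ∃ f : Fin β.len → Fin n, β.OccursAt {a | β.barred a = false} σ f ∧
    ¬ ∃ g : Fin β.len → Fin n,
      (∀ a, β.barred a = false → g a = f a) ∧ β.OccursAt Set.univ σ g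

/-- The set `S_n(β₁, β₂, …)` of permutations that avoid every pattern of the collection `B`. -/
def avoidanceSet (n : ℕ) (B : Set BarredPattern) : Set (Equiv.Perm (Fin n)) :=
  {σ | ∀ β ∈ B, ¬ β.ContainedIn σ}

/-- The barred pattern `3-1̄-42`. -/
def pattern3_bar1_42 : BarredPattern where
  len := 4
  letter := ![3, 1, 4, 2]
  barred := ![false, true, false, false]
  dashAfter := ![true, true, false, false]

/-- The barred pattern `31-4̄-2`. -/
def pattern31_bar4_2 : BarredPattern where
  len := 4
  letter := ![3, 1, 4, 2]
  barred := ![false, false, true, false]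
  dashAfter := ![false, true, true, false]

/-! ### Extended Patience Sorting -/

/-- One-line notation `σ₁σ₂⋯σₙ`, with entries in `{1, …, n}`. -/
def oneLine {n : ℕ} (σ : Equiv.Perm (Fin n)) : List ℕ :=
  List.ofFn fun i => (σ i : ℕ) + 1

/-- Play card `c` as the `i`-th card on the list of pairs `(r_j, s_j)` of insertion and recording
piles, ordered from left to right; every pile is listed from bottom to top. The card goes atop the
left-most pile `r_j` whose top card is larger than `c`, and `i` goes to the bottom of `s_j`;
if there is no such pile, `c` and `i` form new right-most piles. -/
def playCard (c i : ℕ) : List (List ℕ × List ℕ) → List (List ℕ × List ℕ)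
  | [] => [([c], [i])]
  | (r, s) :: piles =>
      if r.getLast?.any (fun d => decide (c < d)) then (r ++ [c], i :: s) :: piles
      else (r, s) :: playCard c i piles

/-- Extended Patience Sorting of a word: play its cards, numbered `1, 2, …`, one after another. -/
def extendedPatienceSorting (w : List ℕ) : List (List ℕ × List ℕ) :=
  (w.zipIdx 1).foldl (fun piles ci => playCard ci.1 ci.2 piles) []

/-- The insertion piles `R(σ)`, from left to right, each listed from bottom to top. -/
def insertionPiles {n : ℕ} (σ : Equiv.Perm (Fin n)) : List (List ℕ) :=
  (extendedPatienceSorting (oneLine σ)).map Prod.fst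

/-- The recording piles `S(σ)`, from left to right, each listed from bottom to top. -/
def recordingPiles {n : ℕ} (σ : Equiv.Perm (Fin n)) : List (List ℕ) :=
  (extendedPatienceSorting (oneLine σ)).map Prod.snd

/-- `RPW(R)`: the piles of `R` read from bottom to top, left to right. -/
def reversePatienceWord (R : List (List ℕ)) : List ℕ := R.flatten

/-- `σ` is the reverse patience word of the pile configuration of some permutation. -/
def IsReversePatienceWord {n : ℕ} (σ : Equiv.Perm (Fin n)) : Prop :=
  ∃ τ : Equiv.Perm (Fin n), oneLine σ = reversePatienceWord (insertionPiles τ)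

/-- The bottom row of a pile configuration, from left to right. -/
def bottomRow (R : List (List ℕ)) : List ℕ := R.filterMap List.head?

/-! ### Southwest shadow diagrams -/

/-- A lattice point as a point of the plane. -/
def toPlane (p : ℤ × ℤ) : ℝ × ℝ := ((p.1 : ℝ), (p.2 : ℝ))

/-- The southwest shadow `U(p)` of a lattice point. -/
def shadow (p : ℤ × ℤ) : Set (ℝ × ℝ) := {z | z.1 ≤ p.1 ∧ z.2 ≤ p.2}

/-- The southwest shadowline of a set of lattice points: the boundary of the union of their
shadows. -/
def shadowline (P : Set (ℤ × ℤ)) : Set (ℝ × ℝ) := frontier (⋃ p ∈ P, shadow p)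

/-- The points of `A` whose shadow contains no other point of `A`. -/
def generators (A : Set (ℤ × ℤ)) : Set (ℤ × ℤ) :=
  {p ∈ A | ∀ q ∈ A, toPlane q ∈ shadow p → q = p}

/-- The permutation diagram `{(1, σ₁), …, (n, σₙ)}`. -/
def permDiagram {n : ℕ} (σ : Equiv.Perm (Fin n)) : Set (ℤ × ℤ) :=
  Set.range fun i : Fin n => (((i : ℕ) : ℤ) + 1, ((σ i : ℕ) : ℤ) + 1)

/-- The points of the permutation diagram that lie on none of the first `j` shadowlines. -/
def remainingPoints {n : ℕ} (σ : Equiv.Perm (Fin n)) : ℕ → Set (ℤ × ℤ)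
  | 0 => permDiagram σ
  | j + 1 => {p ∈ remainingPoints σ j |
      toPlane p ∉ shadowline (generators (remainingPoints σ j))}

/-- The 0th-iterate southwest shadow diagram `D⁽⁰⁾(σ)`, as a set of shadowlines: as long as some
point lies on none of the first `j` shadowlines, the next one is formed. -/
def shadowDiagram {n : ℕ} (σ : Equiv.Perm (Fin n)) : Set (Set (ℝ × ℝ)) :=
  {L | ∃ j : ℕ, (remainingPoints σ j).Nonempty ∧
    L = shadowline (generators (remainingPoints σ j))}

/-- Distinct shadowlines of `D⁽⁰⁾(σ)` do not intersect. -/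
def HasNonintersectingShadowDiagram {n : ℕ} (σ : Equiv.Perm (Fin n)) : Prop :=
  (shadowDiagram σ).Pairwise Disjoint

end PatienceSorting

namespace PatienceSorting

/-! ### Pointwise forms of the two patterns -/

/-! Both patterns speak about ascents. Avoiding `3-1̄-42` means that the bottom of every ascent lies
below all later entries (`AscentBottomsAreLow`); avoiding `31-4̄-2` means that the top of every
ascent lies above all earlier entries (`AscentTopsAreHigh`).

The first condition alone describes reverse patience words. Insertion piles decrease, and the top of
each is at most every card further right, so in the flattened piles an ascent can only start at a
pile top, which is low. Conversely, low ascent bottoms make the descending runs of `σ` such a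
configuration, and sorting `σ` returns exactly these runs as piles. The recording bottoms are then
the end positions of the runs; the insertion bottoms are the first entries of the runs, which
increase when ascent tops are high.

Under the first condition the shadowlines are those of the descending runs. If ascent tops are high,
the first point of a run lies strictly northeast of every point of earlier runs, so no lines meet.
If an ascent top has a larger entry before it, the lines of the two runs involved each reach beyond
the other somewhere, and the intermediate value theorem makes them meet (`not_disjoint_shadowline`).
-/

theorem pattern3_bar1_42_containedIn_iff {n : ℕ} (σ : Equiv.Perm (Fin n)) :
    pattern3_bar1_42.ContainedIn σ ↔ ∃ i j j' : Fin n, (j' : ℕ) = j + 1 ∧ i < j ∧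
      σ j' < σ i ∧ σ i < σ j ∧ ∀ l, i < l → l < j → σ j' < σ l := by
  constructor
  · rintro ⟨f, ⟨h1, h2, h3⟩, h4⟩
    have h02 := h1 (0 : Fin 4) rfl (2 : Fin 4) rfl (by decide)
    have v02 := (h2 (0 : Fin 4) rfl (2 : Fin 4) rfl).2 (by decide)
    have v30 := (h2 (3 : Fin 4) rfl (0 : Fin 4) rfl).2 (by decide)
    have a23 := h3 (2 : Fin 4) rfl (3 : Fin 4) rfl rfl rfl
    refine ⟨f (0 : Fin 4), f (2 : Fin 4), f (3 : Fin 4), a23, h02, v30, v02, ?_⟩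
    intro l hl1 hl2
    by_contra hl
    have hne : l ≠ f (3 : Fin 4) := by
      rintro rfl; simp only [Fin.lt_def] at *; omega
    have hl' : σ l < σ (f (3 : Fin 4)) :=
      lt_of_le_of_ne (not_lt.1 hl) (fun h => hne (σ.injective h))
    have h23 : f (2 : Fin 4) < f (3 : Fin 4) := by rw [Fin.lt_def]; omega
    apply h4
    -- An entry below the `2` and between the `3` and the `4` plays the barred `1`.
    refine ⟨(![f (0 : Fin 4), l, f (2 : Fin 4), f (3 : Fin 4)] : Fin 4 → Fin n), ?_, ?_, ?_, ?_⟩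
    · change ∀ a : Fin 4, _
      intro a
      fin_cases a <;> simp [pattern3_bar1_42]
    · change ∀ a : Fin 4, _ → ∀ b : Fin 4, _
      intro a _ b _
      fin_cases a <;> fin_cases b <;> simp <;> order
    · change ∀ a : Fin 4, _ → ∀ b : Fin 4, _
      intro a _ b _
      fin_cases a <;> fin_cases b <;> simp [pattern3_bar1_42] <;> order
    · change ∀ a : Fin 4, _ → ∀ b : Fin 4, _
      intro a _ b _
      fin_cases a <;> fin_cases b <;> simp [pattern3_bar1_42, a23]
  · rintro ⟨i, j, j', hj', hij, v1, v2, hl⟩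
    have hjj' : j < j' := by rw [Fin.lt_def]; omega
    -- The second `i` is a dummy at the barred place, which `OccursAt` ignores.
    refine ⟨(![i, i, j, j'] : Fin 4 → Fin n), ⟨?_, ?_, ?_⟩, ?_⟩
    · change ∀ a : Fin 4, _ → ∀ b : Fin 4, _
      intro a ha b hb
      fin_cases a <;> fin_cases b <;>
        first
        | cases (show true = false from ha)
        | cases (show true = false from hb)
        | (simp [pattern3_bar1_42] <;> order)
    · change ∀ a : Fin 4, _ → ∀ b : Fin 4, _
      intro a ha b hb
      fin_cases a <;> fin_cases b <;>
        first
        | cases (show true = false from ha)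
        | cases (show true = false from hb)
        | (simp [pattern3_bar1_42] <;> order)
    · change ∀ a : Fin 4, _ → ∀ b : Fin 4, _
      intro a ha b hb
      fin_cases a <;> fin_cases b <;> simp [pattern3_bar1_42, hj'] at ha hb ⊢
    · rintro ⟨g, hg, g1, g2, -⟩
      have e0 : g (0 : Fin 4) = i := hg (0 : Fin 4) rfl
      have e2 : g (2 : Fin 4) = j := hg (2 : Fin 4) rfl
      have e3 : g (3 : Fin 4) = j' := hg (3 : Fin 4) rfl
      have o1 := g1 (0 : Fin 4) trivial (1 : Fin 4) trivial (by decide)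
      have o2 := g1 (1 : Fin 4) trivial (2 : Fin 4) trivial (by decide)
      have o3 := (g2 (1 : Fin 4) trivial (3 : Fin 4) trivial).2 (by decide)
      rw [e0] at o1
      rw [e2] at o2
      rw [e3] at o3
      exact absurd o3 (hl _ o1 o2).asymm

theorem pattern31_bar4_2_containedIn_iff {n : ℕ} (σ : Equiv.Perm (Fin n)) :
    pattern31_bar4_2.ContainedIn σ ↔ ∃ i i' j : Fin n, (i' : ℕ) = i + 1 ∧ i' < j ∧
      σ i' < σ j ∧ σ j < σ i ∧ ∀ l, i' < l → l < j → σ l < σ i := by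
  constructor
  · rintro ⟨f, ⟨h1, h2, h3⟩, h4⟩
    have h13 := h1 (1 : Fin 4) rfl (3 : Fin 4) rfl (by decide)
    have v13 := (h2 (1 : Fin 4) rfl (3 : Fin 4) rfl).2 (by decide)
    have v30 := (h2 (3 : Fin 4) rfl (0 : Fin 4) rfl).2 (by decide)
    have a01 := h3 (0 : Fin 4) rfl (1 : Fin 4) rfl rfl rfl
    refine ⟨f (0 : Fin 4), f (1 : Fin 4), f (3 : Fin 4), a01, h13, v13, v30, ?_⟩
    intro l hl1 hl2
    by_contra hl
    have hne : l ≠ f (0 : Fin 4) := by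
      rintro rfl; simp only [Fin.lt_def] at *; omega
    have hl' : σ (f (0 : Fin 4)) < σ l :=
      lt_of_le_of_ne (not_lt.1 hl) (fun h => hne (σ.injective h.symm))
    have h01 : f (0 : Fin 4) < f (1 : Fin 4) := by rw [Fin.lt_def]; omega
    apply h4
    refine ⟨(![f (0 : Fin 4), f (1 : Fin 4), l, f (3 : Fin 4)] : Fin 4 → Fin n), ?_, ?_, ?_, ?_⟩
    · change ∀ a : Fin 4, _
      intro a
      fin_cases a <;> simp [pattern31_bar4_2]
    · change ∀ a : Fin 4, _ → ∀ b : Fin 4, _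
      intro a _ b _
      fin_cases a <;> fin_cases b <;> simp <;> order
    · change ∀ a : Fin 4, _ → ∀ b : Fin 4, _
      intro a _ b _
      fin_cases a <;> fin_cases b <;> simp [pattern31_bar4_2] <;> order
    · change ∀ a : Fin 4, _ → ∀ b : Fin 4, _
      intro a _ b _
      fin_cases a <;> fin_cases b <;> simp [pattern31_bar4_2, a01]
  · rintro ⟨i, i', j, hi', hij, v1, v2, hl⟩
    have hii' : i < i' := by rw [Fin.lt_def]; omega
    refine ⟨(![i, i', i, j] : Fin 4 → Fin n), ⟨?_, ?_, ?_⟩, ?_⟩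
    · change ∀ a : Fin 4, _ → ∀ b : Fin 4, _
      intro a ha b hb
      fin_cases a <;> fin_cases b <;>
        first
        | cases (show true = false from ha)
        | cases (show true = false from hb)
        | (simp [pattern31_bar4_2] <;> order)
    · change ∀ a : Fin 4, _ → ∀ b : Fin 4, _
      intro a ha b hb
      fin_cases a <;> fin_cases b <;>
        first
        | cases (show true = false from ha)
        | cases (show true = false from hb)
        | (simp [pattern31_bar4_2] <;> order)
    · change ∀ a : Fin 4, _ → ∀ b : Fin 4, _
      intro a ha b hb
      fin_cases a <;> fin_cases b <;> simp [pattern31_bar4_2, hi'] at ha hb ⊢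
    · rintro ⟨g, hg, g1, g2, -⟩
      have e0 : g (0 : Fin 4) = i := hg (0 : Fin 4) rfl
      have e1 : g (1 : Fin 4) = i' := hg (1 : Fin 4) rfl
      have e3 : g (3 : Fin 4) = j := hg (3 : Fin 4) rfl
      have o1 := g1 (1 : Fin 4) trivial (2 : Fin 4) trivial (by decide)
      have o2 := g1 (2 : Fin 4) trivial (3 : Fin 4) trivial (by decide)
      have o3 := (g2 (0 : Fin 4) trivial (2 : Fin 4) trivial).2 (by decide)
      rw [e1] at o1
      rw [e3] at o2
      rw [e0] at o3
      exact absurd o3 (hl _ o1 o2).asymm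

/-- The lower entry of every ascent of `σ` is smaller than all later entries. -/
def AscentBottomsAreLow {n : ℕ} (σ : Equiv.Perm (Fin n)) : Prop :=
  ∀ e e' : Fin n, (e' : ℕ) = e + 1 → σ e < σ e' → ∀ j, e < j → σ e < σ j

/-- The upper entry of every ascent of `σ` is larger than all earlier entries. -/
def AscentTopsAreHigh {n : ℕ} (σ : Equiv.Perm (Fin n)) : Prop :=
  ∀ e e' : Fin n, (e' : ℕ) = e + 1 → σ e < σ e' → ∀ i, i < e' → σ i < σ e'

/-- Used in contrapositive form: a larger entry further right forces an ascent in between. -/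
theorem lt_of_no_ascent {n : ℕ} (σ : Equiv.Perm (Fin n)) {i j : Fin n} (hij : i < j)
    (h : ∀ e e' : Fin n, (e' : ℕ) = e + 1 → i ≤ e → e' ≤ j → ¬ σ e < σ e') : σ j < σ i := by
  obtain ⟨j, hj⟩ := j
  induction j with
  | zero => simp [Fin.lt_def] at hij
  | succ k ih =>
    have hk : k < n := by omega
    have hle : i ≤ ⟨k, hk⟩ := by simp only [Fin.lt_def, Fin.le_def] at *; omega
    have hstep : σ ⟨k + 1, hj⟩ < σ ⟨k, hk⟩ :=
      lt_of_le_of_ne (not_lt.1 (h ⟨k, hk⟩ ⟨k + 1, hj⟩ rfl hle le_rfl))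
        (fun h => by simpa using σ.injective h)
    rcases hle.lt_or_eq with hlt | heq
    · refine hstep.trans (ih hk hlt fun e e' h1 h2 h3 => h e e' h1 h2 ?_)
      simp only [Fin.le_def] at *; omega
    · rwa [heq]

/-- If an ascent bottom `e` is not low, the first later `j` with `σ j < σ e` gives the occurrence
`e`, `j - 1`, `j`, with nothing low enough in between. Conversely, an occurrence has an ascent
between its `3` and its `4`, and the bottom of that ascent exceeds the `2`. -/
theorem not_contains_pattern3_bar1_42_iff {n : ℕ} (σ : Equiv.Perm (Fin n)) :
    ¬ pattern3_bar1_42.ContainedIn σ ↔ AscentBottomsAreLow σ := by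
  rw [pattern3_bar1_42_containedIn_iff]
  constructor
  · intro h e e' he hasc j
    induction j using WellFoundedLT.induction with
    | _ j ih =>
    intro hej
    by_contra hcon
    have hlt : σ j < σ e := lt_of_le_of_ne (not_lt.1 hcon) (fun h => hej.ne' (σ.injective h))
    have hne : j ≠ e' := by rintro rfl; order
    have hne' : (j : ℕ) ≠ e' := fun h => hne (Fin.ext h)
    have hej' : (e : ℕ) < j := hej
    have hb : (j : ℕ) - 1 < n := by omega
    have hlow := ih ⟨j - 1, hb⟩ (by rw [Fin.lt_def]; simp only; omega)
      (by rw [Fin.lt_def]; simp only; omega)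
    refine h ⟨e, ⟨j - 1, hb⟩, j, by simp only; omega, by rw [Fin.lt_def]; simp only; omega,
      hlt, hlow, fun l h1 h2 => hlt.trans (ih l ?_ h1)⟩
    simp only [Fin.lt_def] at *; omega
  · rintro h ⟨i, j, j', hj', hij, v1, v2, hl⟩
    refine absurd (lt_of_no_ascent σ hij fun e e' he h1 h2 hasc => ?_) v2.asymm
    have hej' : e < j' := by simp only [Fin.le_def, Fin.lt_def] at *; omega
    have hlow := h e e' he hasc j' hej'
    have hej : e < j := by simp only [Fin.le_def, Fin.lt_def] at *; omega
    rcases h1.lt_or_eq with hlt | rfl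
    · exact hlow.asymm (hl e hlt hej)
    · exact hlow.asymm v1

/-- The mirror image under reverse-complement: here the induction runs leftwards and finds the last
earlier entry above the ascent top. -/
theorem not_contains_pattern31_bar4_2_iff {n : ℕ} (σ : Equiv.Perm (Fin n)) :
    ¬ pattern31_bar4_2.ContainedIn σ ↔ AscentTopsAreHigh σ := by
  rw [pattern31_bar4_2_containedIn_iff]
  constructor
  · intro h e e' he hasc i
    induction i using WellFoundedGT.induction with
    | _ i ih =>
    intro hie
    by_contra hcon
    have hlt : σ e' < σ i := lt_of_le_of_ne (not_lt.1 hcon) (fun h => hie.ne' (σ.injective h))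
    have hne : i ≠ e := by rintro rfl; order
    have hne' : (i : ℕ) ≠ e := fun h => hne (Fin.ext h)
    have hie' : (i : ℕ) < e' := hie
    have hb : (i : ℕ) + 1 < n := by omega
    have hhigh := ih ⟨i + 1, hb⟩ (by rw [Fin.lt_def]; simp only; omega)
      (by rw [Fin.lt_def]; simp only; omega)
    refine h ⟨i, ⟨i + 1, hb⟩, e', by simp only, by rw [Fin.lt_def]; simp only; omega,
      hhigh, hlt, fun l h1 h2 => (ih l ?_ h2).trans hlt⟩
    simp only [Fin.lt_def] at *; omega
  · rintro h ⟨i, i', j, hi', hij, v1, v2, hl⟩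
    refine absurd (lt_of_no_ascent σ hij fun e e' he h1 h2 hasc => ?_) v1.asymm
    have hie : i < e' := by simp only [Fin.le_def, Fin.lt_def] at *; omega
    have hhigh := h e e' he hasc i hie
    have hie : i' < e' := by simp only [Fin.le_def, Fin.lt_def] at *; omega
    rcases h2.lt_or_eq with hlt | rfl
    · exact hhigh.asymm (hl e' hie hlt)
    · exact hhigh.asymm v2

/-! ### Pile configurations -/

/-- Nonempty decreasing piles whose top cards weakly increase from left to right. -/
structure IsPileConfiguration (D : List (List ℕ)) : Prop where
  ne_nil : ∀ d ∈ D, d ≠ []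
  decreasing : ∀ d ∈ D, d.Pairwise (· > ·)
  tops : D.Pairwise fun d d' => ∀ x ∈ d.getLast?, ∀ y ∈ d', x ≤ y

theorem le_of_mem_getLast? {d : List ℕ} (hd : d.Pairwise (· > ·)) {x y : ℕ}
    (hx : x ∈ d.getLast?) (hy : y ∈ d) : x ≤ y := by
  obtain ⟨u, rfl⟩ := List.getLast?_eq_some_iff.1 hx
  rcases List.mem_append.1 hy with h | h
  · exact ((List.pairwise_append.1 hd).2.2 y h x (by simp)).le
  · exact (List.mem_singleton.1 h).ge

theorem isPileConfiguration_cons {d : List ℕ} {D : List (List ℕ)} :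
    IsPileConfiguration (d :: D) ↔ d ≠ [] ∧ d.Pairwise (· > ·) ∧
      (∀ x ∈ d.getLast?, ∀ d' ∈ D, ∀ y ∈ d', x ≤ y) ∧ IsPileConfiguration D := by
  constructor
  · rintro ⟨h1, h2, h3⟩
    rw [List.pairwise_cons] at h3
    exact ⟨h1 d (by simp), h2 d (by simp), fun x hx d' hd' => h3.1 d' hd' x hx,
      fun e he => h1 e (by simp [he]), fun e he => h2 e (by simp [he]), h3.2⟩
  · rintro ⟨h1, h2, h3, h4⟩
    refine ⟨?_, ?_, ?_⟩
    · simpa using ⟨h1, h4.ne_nil⟩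
    · simpa using ⟨h2, h4.decreasing⟩
    · rw [List.pairwise_cons]
      exact ⟨fun d' hd' x hx => h3 x hx d' hd', h4.tops⟩

theorem mem_of_mem_playCard {c i y : ℕ} {P : List (List ℕ × List ℕ)} {d : List ℕ}
    (hd : d ∈ (playCard c i P).map Prod.fst) (hy : y ∈ d) :
    y = c ∨ ∃ d' ∈ P.map Prod.fst, y ∈ d' := by
  induction P with
  | nil => simp_all [playCard]
  | cons p P ih =>
    obtain ⟨r, s⟩ := p
    rw [playCard] at hd
    split at hd
    · rw [List.map_cons, List.mem_cons] at hd
      rcases hd with rfl | hd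
      · rcases List.mem_append.1 hy with h | h
        · exact Or.inr ⟨r, by simp, h⟩
        · exact Or.inl (by simpa using h)
      · exact Or.inr ⟨d, by simp [hd], hy⟩
    · rw [List.map_cons, List.mem_cons] at hd
      rcases hd with rfl | hd
      · exact Or.inr ⟨d, by simp, hy⟩
      · rcases ih hd with h | ⟨d', h1, h2⟩
        · exact Or.inl h
        · exact Or.inr ⟨d', by rw [List.map_cons]; exact List.mem_cons_of_mem _ h1, h2⟩

/-- Every pile passed over has top at most `c`, and the pile receiving `c` only has its top lowered,
so the comparisons with cards further right survive. -/
theorem IsPileConfiguration.playCard {c i : ℕ} {P : List (List ℕ × List ℕ)}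
    (h : IsPileConfiguration (P.map Prod.fst)) :
    IsPileConfiguration ((playCard c i P).map Prod.fst) := by
  induction P with
  | nil => exact ⟨by simp [PatienceSorting.playCard], by simp [PatienceSorting.playCard],
      by simp [PatienceSorting.playCard]⟩
  | cons p P ih =>
    obtain ⟨r, s⟩ := p
    rw [List.map_cons, isPileConfiguration_cons] at h
    obtain ⟨h1, h2, h3, h4⟩ := h
    obtain ⟨d, hd⟩ : ∃ d, d ∈ r.getLast? := by
      simpa [Option.mem_def, ← Option.isSome_iff_exists] using h1
    rw [PatienceSorting.playCard]
    have hd' : r.getLast? = some d := hd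
    split
    · rename_i hc
      have hcd : c < d := by simpa [hd'] using hc
      rw [List.map_cons, isPileConfiguration_cons]
      refine ⟨by simp, ?_, ?_, h4⟩
      · rw [List.pairwise_append]
        refine ⟨h2, by simp, ?_⟩
        intro y hy z hz
        rw [List.mem_singleton] at hz
        have := le_of_mem_getLast? h2 hd hy
        omega
      · intro x hx d' hd'' y hy
        have hx : c = x := by simpa using hx
        have := h3 d hd d' hd'' y hy
        omega
    · rename_i hc
      have hcd : d ≤ c := by simpa [hd'] using hc
      rw [List.map_cons, isPileConfiguration_cons]
      refine ⟨h1, h2, ?_, ih h4⟩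
      intro x hx d' hd'' y hy
      have hx : x = d := by simpa [hd', eq_comm] using hx
      subst hx
      rcases mem_of_mem_playCard hd'' hy with rfl | ⟨e, he, hy⟩
      · exact hcd
      · exact h3 x hd e he y hy

theorem isPileConfiguration_insertionPiles {n : ℕ} (τ : Equiv.Perm (Fin n)) :
    IsPileConfiguration (insertionPiles τ) := by
  have key : ∀ (w : List (ℕ × ℕ)) (P : List (List ℕ × List ℕ)),
      IsPileConfiguration (P.map Prod.fst) → IsPileConfiguration
        ((w.foldl (fun piles ci => playCard ci.1 ci.2 piles) P).map Prod.fst) := by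
    intro w
    induction w with
    | nil => exact fun P h => h
    | cons c w ih => exact fun P h => ih _ h.playCard
  exact key _ [] ⟨by simp, by simp, by simp⟩

/-- Piles decrease, so `a ≤ b` puts `a` on top of its pile, and all that follows lies in later
piles. -/
theorem IsPileConfiguration.le_of_flatten_eq {D : List (List ℕ)} (h : IsPileConfiguration D)
    {u v : List ℕ} {a b : ℕ} (hD : D.flatten = u ++ a :: b :: v) (hab : a ≤ b) :
    ∀ x ∈ b :: v, a ≤ x := by
  induction D generalizing u with
  | nil => simp at hD
  | cons d D ih =>
    rw [isPileConfiguration_cons] at h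
    obtain ⟨h1, h2, h3, h4⟩ := h
    rw [List.flatten_cons, List.append_eq_append_iff] at hD
    rcases hD with ⟨as, rfl, hD⟩ | ⟨as, rfl, hD⟩
    · exact ih h4 hD
    · rcases as with _ | ⟨a', _ | ⟨b', t⟩⟩
      · exact ih (u := []) h4 (by simpa using hD.symm)
      · simp only [List.cons_append, List.nil_append, List.cons.injEq] at hD
        obtain ⟨rfl, hD⟩ := hD
        intro x hx
        rw [hD, List.mem_flatten] at hx
        obtain ⟨d', hd', hx⟩ := hx
        exact h3 a (by simp) d' hd' x hx
      · simp only [List.cons_append, List.cons.injEq] at hD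
        obtain ⟨rfl, rfl, -⟩ := hD
        have := List.pairwise_append.1 h2 |>.2.1
        simp only [List.pairwise_cons] at this
        have := this.1 b (by simp)
        omega

/-! ### Patience sorting of a reverse patience word -/

theorem playCard_append {c i : ℕ} {P Q : List (List ℕ × List ℕ)}
    (h : ∀ p ∈ P, ∀ x ∈ p.1.getLast?, x ≤ c) :
    playCard c i (P ++ Q) = P ++ playCard c i Q := by
  induction P with
  | nil => rfl
  | cons p P ih =>
    obtain ⟨r, s⟩ := p
    rw [List.cons_append, playCard, if_neg, ih (fun p hp => h p (by simp [hp]))]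
    · rfl
    · have := h (r, s) (by simp)
      rcases hr : r.getLast? with _ | d
      · simp
      · simpa using this d hr

/-- Each card of `d` passes all of `P` and is smaller than the current top of the last pile.
Positions enter recording piles at the bottom, hence the reversal. -/
theorem foldl_playCard_pile {P : List (List ℕ × List ℕ)} {d r s : List ℕ} {k : ℕ}
    (h : ∀ p ∈ P, ∀ x ∈ p.1.getLast?, ∀ y ∈ d, x ≤ y) (hr : r ≠ [])
    (hd : (r ++ d).Pairwise (· > ·)) :
    (d.zipIdx k).foldl (fun piles ci => playCard ci.1 ci.2 piles) (P ++ [(r, s)]) =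
      P ++ [(r ++ d, (List.range' k d.length).reverse ++ s)] := by
  induction d generalizing r s k with
  | nil => simp
  | cons c d ih =>
    rw [List.zipIdx_cons, List.foldl_cons,
      playCard_append (fun p hp x hx => h p hp x hx c (by simp)), playCard, if_pos]
    · rw [ih (fun p hp x hx y hy => h p hp x hx y (by simp [hy])) (by simp) (by simpa using hd)]
      simp [List.range'_succ]
    · obtain ⟨u, z, rfl⟩ := List.eq_nil_or_concat' r |>.resolve_left hr
      have := (List.pairwise_append.1 hd).2.2 z (by simp) c (by simp)
      simpa using this

theorem extendedPatienceSorting_append {w d : List ℕ} (hd : d.Pairwise (· > ·)) (hne : d ≠ [])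
    (h : ∀ p ∈ extendedPatienceSorting w, ∀ x ∈ p.1.getLast?, ∀ y ∈ d, x ≤ y) :
    extendedPatienceSorting (w ++ d) = extendedPatienceSorting w ++
      [(d, (List.range' (w.length + 1) d.length).reverse)] := by
  obtain ⟨c, d, rfl⟩ := List.exists_cons_of_ne_nil hne
  have hfold : extendedPatienceSorting (w ++ c :: d) =
      ((c :: d).zipIdx (w.length + 1)).foldl (fun piles ci => playCard ci.1 ci.2 piles)
        (extendedPatienceSorting w) := by
    rw [extendedPatienceSorting, List.zipIdx_append, List.foldl_append, Nat.add_comm]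
    rfl
  have hplay := playCard_append (Q := []) (i := w.length + 1)
    (fun p hp x hx => h p hp x hx c (by simp))
  rw [List.append_nil] at hplay
  rw [hfold, List.zipIdx_cons, List.foldl_cons, hplay, playCard,
    foldl_playCard_pile (fun p hp x hx y hy => h p hp x hx y (by simp [hy])) (by simp)
      (by simpa using hd)]
  simp [List.range'_succ]

/-- Each pile is played as one block and becomes a new right-most pile, whose recording bottom is
the length of the word read so far. The last clause is the bound that carries the induction. -/
theorem IsPileConfiguration.extendedPatienceSorting_flatten {D : List (List ℕ)}
    (h : IsPileConfiguration D) :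
    (extendedPatienceSorting D.flatten).map Prod.fst = D ∧
    (bottomRow ((extendedPatienceSorting D.flatten).map Prod.snd)).Pairwise (· < ·) ∧
    ∀ x ∈ bottomRow ((extendedPatienceSorting D.flatten).map Prod.snd), x ≤ D.flatten.length := by
  induction D using List.reverseRecOn with
  | nil => simp [extendedPatienceSorting, bottomRow]
  | append_singleton D d ih =>
    have hD : IsPileConfiguration D := ⟨fun e he => h.ne_nil e (by simp [he]),
      fun e he => h.decreasing e (by simp [he]), (List.pairwise_append.1 h.tops).1⟩
    obtain ⟨i1, i2, i3⟩ := ih hD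
    have hne := h.ne_nil d (by simp)
    have hpos := List.length_pos_of_ne_nil hne
    have heq := extendedPatienceSorting_append (w := D.flatten) (h.decreasing d (by simp)) hne
      (by
        intro p hp x hx y hy
        refine (List.pairwise_append.1 h.tops).2.2 p.1 ?_ d (by simp) x hx y hy
        rw [← i1]
        exact List.mem_map_of_mem hp)
    have hrow : bottomRow ((extendedPatienceSorting (D ++ [d]).flatten).map Prod.snd) =
        bottomRow ((extendedPatienceSorting D.flatten).map Prod.snd) ++
          [(D ++ [d]).flatten.length] := by
      have hlast : (List.range' (D.flatten.length + 1) d.length).reverse.head? =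
          some (D.flatten.length + d.length) := by
        rw [List.head?_reverse, List.getLast?_range', if_neg (by omega)]
        congr 1
        omega
      rw [List.flatten_append, List.flatten_singleton, heq, bottomRow, List.map_append,
        List.filterMap_append, bottomRow]
      rw [List.map_singleton, List.filterMap_cons_some hlast]
      simp
    refine ⟨?_, ?_, ?_⟩
    · rw [List.flatten_append, List.flatten_singleton, heq, List.map_append, i1]
      rfl
    · rw [hrow, List.pairwise_append]
      refine ⟨i2, by simp, fun x hx y hy => ?_⟩
      have := i3 x hx
      simp at hy this ⊢
      omega
    · rw [hrow]
      intro x hx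
      rcases List.mem_append.1 hx with hx | hx
      · have := i3 x hx
        simp at this ⊢
        omega
      · exact (List.mem_singleton.1 hx).le

/-! ### Reverse patience words and descending runs. -/

theorem oneLine_split {n : ℕ} {σ : Equiv.Perm (Fin n)} {u v : List ℕ} {a b : ℕ}
    (h : oneLine σ = u ++ a :: b :: v) :
    ∃ e e' : Fin n, (e' : ℕ) = e + 1 ∧ a = σ e + 1 ∧ b = σ e' + 1 ∧
      (∀ x ∈ u, ∃ i < e, x = σ i + 1) ∧ ∀ x ∈ v, ∃ j, e < j ∧ x = σ j + 1 := by
  have hlen : n = u.length + (v.length + 2) := by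
    have := congrArg List.length h
    simpa [oneLine] using this
  have hget : ∀ (k : ℕ) (hk : k < n), (u ++ a :: b :: v)[k]? = some ((σ ⟨k, hk⟩ : ℕ) + 1) := by
    intro k hk
    rw [← h, oneLine, List.getElem?_ofFn, dif_pos hk]
  refine ⟨⟨u.length, by omega⟩, ⟨u.length + 1, by omega⟩, rfl, ?_, ?_, ?_, ?_⟩
  · have := hget u.length (by omega)
    simpa using this
  · have := hget (u.length + 1) (by omega)
    simpa [List.getElem?_append_right] using this
  · intro x hx
    obtain ⟨k, hk, rfl⟩ := List.getElem_of_mem hx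
    refine ⟨⟨k, by omega⟩, hk, ?_⟩
    have := hget k (by omega)
    simpa [List.getElem?_append_left hk, hk] using this
  · intro x hx
    obtain ⟨k, hk, rfl⟩ := List.getElem_of_mem hx
    refine ⟨⟨u.length + (k + 2), by omega⟩, by rw [Fin.lt_def]; simp, ?_⟩
    have := hget (u.length + (k + 2)) (by omega)
    simpa [List.getElem?_append_right, hk] using this

theorem IsReversePatienceWord.ascentBottomsAreLow {n : ℕ} {σ : Equiv.Perm (Fin n)}
    (h : IsReversePatienceWord σ) : AscentBottomsAreLow σ := by
  obtain ⟨τ, hτ⟩ := h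
  intro e e' he hasc j hej
  have hlen : (oneLine σ).length = n := by simp [oneLine]
  have hget : ∀ (k : ℕ) (hk : k < (oneLine σ).length),
      (oneLine σ)[k] = (σ ⟨k, hlen ▸ hk⟩ : ℕ) + 1 := by
    intro k hk
    simp [oneLine]
  have he1 : (e : ℕ) + 1 < (oneLine σ).length := by omega
  have hsplit : oneLine σ = (oneLine σ).take e ++
      (oneLine σ)[(e : ℕ)] :: (oneLine σ)[(e : ℕ) + 1] :: (oneLine σ).drop (e + 2) := by
    conv_lhs => rw [← List.take_append_drop e (oneLine σ),
      List.drop_eq_getElem_cons (by omega), List.drop_eq_getElem_cons he1]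
  have hee' : (⟨(e : ℕ) + 1, by omega⟩ : Fin n) = e' := Fin.ext he.symm
  have hle := (isPileConfiguration_insertionPiles τ).le_of_flatten_eq
    (hτ.symm.trans hsplit) (by
      rw [hget, hget, hee']
      have : (σ e : ℕ) < σ e' := hasc
      exact Nat.succ_le_succ this.le)
  have hj : (oneLine σ)[(j : ℕ)] ∈ (oneLine σ)[(e : ℕ) + 1] :: (oneLine σ).drop (e + 2) := by
    rw [← List.drop_eq_getElem_cons he1, List.mem_drop_iff_getElem]
    have hej' : (e : ℕ) < j := hej
    refine ⟨j - (e + 1), by omega, ?_⟩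
    congr 1
    omega
  have := hle _ hj
  rw [hget, hget] at this
  exact lt_of_le_of_ne (Nat.le_of_succ_le_succ this) fun h => hej.ne (σ.injective h)

/-- The descending runs of a word. -/
def descendingRuns (w : List ℕ) : List (List ℕ) := w.splitBy fun a b => decide (a > b)

/-- Presents the boundary between two runs as a non-descent, in the shape that `oneLine_split` turns
into an ascent of `σ`. -/
theorem descendingRuns_adjacent {w d d' : List ℕ} {X Y : List (List ℕ)}
    (h : descendingRuns w = X ++ d :: d' :: Y) :
    ∃ s a b t, d = s ++ [a] ∧ d' = b :: t ∧ a ≤ b ∧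
      w = (X.flatten ++ s) ++ a :: b :: (t ++ Y.flatten) := by
  obtain ⟨hd, hd', hab⟩ := List.isChain_iff_forall_rel_of_append_cons_cons.1
    (List.isChain_getLast_head_splitBy (fun a b => decide (a > b)) w) h
  have hw : w = (descendingRuns w).flatten := (List.flatten_splitBy _ w).symm
  rw [h] at hw
  refine ⟨d.dropLast, d.getLast hd, d'.head hd', d'.tail, (List.dropLast_append_getLast hd).symm,
    (List.cons_head_tail hd').symm, by simpa using hab, ?_⟩
  rw [hw]
  conv_lhs => rw [← List.dropLast_append_getLast hd, ← List.cons_head_tail hd']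
  simp only [List.flatten_append, List.flatten_cons, List.append_assoc, List.cons_append,
    List.nil_append]

theorem decreasing_of_mem_descendingRuns {w d : List ℕ} (h : d ∈ descendingRuns w) :
    d.Pairwise (· > ·) := by
  have := List.isChain_of_mem_splitBy h
  simp only [decide_eq_true_eq] at this
  exact this.pairwise

theorem pairwise_of_forall_append_cons {α : Type*} {R : α → α → Prop} {l : List α}
    (h : ∀ X d Z, l = X ++ d :: Z → ∀ d' ∈ Z, R d d') : l.Pairwise R := by
  induction l with
  | nil => exact List.Pairwise.nil
  | cons a l ih =>
    exact List.pairwise_cons.2 ⟨h [] a l rfl,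
      ih fun X d Z hl => h (a :: X) d Z (by rw [hl, List.cons_append])⟩

/-- The last entry of any run but the final one is an ascent bottom, hence below everything in later
runs. -/
theorem AscentBottomsAreLow.isPileConfiguration {n : ℕ} {σ : Equiv.Perm (Fin n)}
    (h : AscentBottomsAreLow σ) : IsPileConfiguration (descendingRuns (oneLine σ)) := by
  have hne : ∀ d ∈ descendingRuns (oneLine σ), d ≠ [] := fun d hd => List.ne_nil_of_mem_splitBy hd
  refine ⟨hne, fun d hd => decreasing_of_mem_descendingRuns hd, ?_⟩
  refine pairwise_of_forall_append_cons fun X d Z hD d' hd' x hx y hy => ?_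
  obtain ⟨d₁, Y, rfl⟩ := List.exists_cons_of_ne_nil (List.ne_nil_of_mem hd')
  obtain ⟨s, a, b, t, rfl, rfl, hab, hw⟩ := descendingRuns_adjacent hD
  obtain ⟨e, e', he, rfl, rfl, -, hv⟩ := oneLine_split hw
  have hlt : e < e' := by rw [Fin.lt_def]; omega
  have hasc : σ e < σ e' := lt_of_le_of_ne (Nat.le_of_succ_le_succ hab)
    fun h => hlt.ne (σ.injective h)
  have hx : (σ e : ℕ) + 1 = x := by simpa using hx
  subst hx
  have hy : y = σ e' + 1 ∨ y ∈ t ++ Y.flatten := by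
    rw [← List.mem_cons, ← List.cons_append, ← List.flatten_cons]
    exact List.mem_flatten.2 ⟨d', hd', hy⟩
  rcases hy with rfl | hy
  · exact hab
  · obtain ⟨j, hj, rfl⟩ := hv y hy
    exact Nat.succ_le_succ (Fin.le_def.1 (h e e' he hasc j hj).le)

theorem AscentBottomsAreLow.insertionPiles_eq {n : ℕ} {σ : Equiv.Perm (Fin n)}
    (h : AscentBottomsAreLow σ) :
    insertionPiles σ = descendingRuns (oneLine σ) := by
  have := h.isPileConfiguration.extendedPatienceSorting_flatten.1
  rwa [descendingRuns, List.flatten_splitBy] at this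

theorem isReversePatienceWord_iff {n : ℕ} (σ : Equiv.Perm (Fin n)) :
    IsReversePatienceWord σ ↔ AscentBottomsAreLow σ := by
  refine ⟨fun h => h.ascentBottomsAreLow, fun h => ⟨σ, ?_⟩⟩
  rw [h.insertionPiles_eq, reversePatienceWord, descendingRuns, List.flatten_splitBy]

theorem AscentBottomsAreLow.bottomRow_recordingPiles {n : ℕ} {σ : Equiv.Perm (Fin n)}
    (h : AscentBottomsAreLow σ) : (bottomRow (recordingPiles σ)).Pairwise (· < ·) := by
  have := h.isPileConfiguration.extendedPatienceSorting_flatten.2.1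
  rwa [descendingRuns, List.flatten_splitBy] at this

theorem AscentBottomsAreLow.bottomRow_insertionPiles {n : ℕ} {σ : Equiv.Perm (Fin n)}
    (h : AscentBottomsAreLow σ) (h' : AscentTopsAreHigh σ) :
    (bottomRow (insertionPiles σ)).Pairwise (· < ·) := by
  rw [h.insertionPiles_eq, bottomRow, List.pairwise_filterMap]
  -- The default `0` makes the relation transitive even at empty lists, so neighbouring runs
  -- suffice; it is never the value compared in the end.
  suffices hchain : (descendingRuns (oneLine σ)).IsChain
      (fun d d' => d.headD 0 < d'.headD 0) by
    have htrans : IsTrans (List ℕ) (fun d d' => d.headD 0 < d'.headD 0) :=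
      ⟨fun _ _ _ => lt_trans⟩
    refine hchain.pairwise.imp fun {d d'} hlt x hx y hy => ?_
    simpa [List.headD_eq_head?_getD, hx, hy] using hlt
  rw [List.isChain_iff_forall_rel_of_append_cons_cons]
  intro d d' X Y hD
  obtain ⟨s, a, b, t, rfl, rfl, hab, hw⟩ := descendingRuns_adjacent hD
  obtain ⟨e, e', he, rfl, rfl, hu, -⟩ := oneLine_split hw
  have hlt : e < e' := by rw [Fin.lt_def]; omega
  have hasc : σ e < σ e' := lt_of_le_of_ne (Nat.le_of_succ_le_succ hab)
    fun h => hlt.ne (σ.injective h)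
  rcases s with _ | ⟨z, s⟩
  · simpa using hasc
  · obtain ⟨i, hi, rfl⟩ := hu z (by simp)
    simpa using h' e e' he hasc i (hi.trans hlt)

/-! ### Shadowlines -/

/-- A finite union of shadows is closed, so its boundary is the union minus its interior; interior
points are those strictly southwest of some generator. -/
theorem mem_shadowline_iff {P : Set (ℤ × ℤ)} (hP : P.Finite) {z : ℝ × ℝ} :
    z ∈ shadowline P ↔ (∃ p ∈ P, z.1 ≤ p.1 ∧ z.2 ≤ p.2) ∧
      ∀ p ∈ P, ¬ (z.1 < p.1 ∧ z.2 < p.2) := by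
  have hclosed : IsClosed (⋃ p ∈ P, shadow p) := by
    refine hP.isClosed_biUnion fun p _ => ?_
    exact (isClosed_le continuous_fst continuous_const).inter
      (isClosed_le continuous_snd continuous_const)
  have hint : z ∈ interior (⋃ p ∈ P, shadow p) ↔ ∃ p ∈ P, z.1 < p.1 ∧ z.2 < p.2 := by
    constructor
    · intro hz
      -- A small diagonal move northeast stays in the union and turns weak inequalities into strict
      -- ones.
      have hcont : Continuous fun ε : ℝ => (z.1 + ε, z.2 + ε) := by fun_prop
      have hmem : ∀ᶠ ε in nhds (0 : ℝ), (z.1 + ε, z.2 + ε) ∈ ⋃ p ∈ P, shadow p := by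
        have hz0 : ⋃ p ∈ P, shadow p ∈ nhds (z.1 + 0, z.2 + 0) := by
          simpa only [add_zero] using mem_interior_iff_mem_nhds.1 hz
        exact hcont.continuousAt.eventually hz0
      obtain ⟨ε, hε, hε0⟩ := ((hmem.filter_mono nhdsWithin_le_nhds).and
        (self_mem_nhdsWithin : Set.Ioi (0 : ℝ) ∈ nhdsWithin 0 (Set.Ioi 0))).exists
      simp only [Set.mem_iUnion, shadow, Set.mem_ofPred_eq] at hε
      obtain ⟨p, hp, h1, h2⟩ := hε
      have hε0 : 0 < ε := hε0
      exact ⟨p, hp, by linarith, by linarith⟩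
    · rintro ⟨p, hp, h1, h2⟩
      refine mem_interior.2 ⟨{y | y.1 < p.1 ∧ y.2 < p.2}, ?_, ?_, h1, h2⟩
      · intro y hy
        exact Set.mem_biUnion hp ⟨hy.1.le, hy.2.le⟩
      · exact (isOpen_lt continuous_fst continuous_const).inter
          (isOpen_lt continuous_snd continuous_const)
  rw [shadowline, hclosed.frontier_eq, Set.mem_sdiff, hint]
  simp only [shadow, Set.mem_iUnion, Set.mem_ofPred_eq, exists_prop, not_exists, not_and]

theorem disjoint_shadowline {P Q : Set (ℤ × ℤ)} (hP : P.Finite) (hQ : Q.Finite)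
    (h : ∀ p ∈ P, ∃ q ∈ Q, p.1 < q.1 ∧ p.2 < q.2) : Disjoint (shadowline P) (shadowline Q) := by
  rw [Set.disjoint_left]
  intro z hzP hzQ
  obtain ⟨⟨p, hp, h1, h2⟩, -⟩ := (mem_shadowline_iff hP).1 hzP
  obtain ⟨q, hq, h3, h4⟩ := h p hp
  exact ((mem_shadowline_iff hQ).1 hzQ).2 q hq
    ⟨h1.trans_lt (Int.cast_lt.2 h3), h2.trans_lt (Int.cast_lt.2 h4)⟩

/-- The abscissa at which the line `x - y = c` leaves the union of the shadows of `P`. -/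
noncomputable def diagonalExit (P : Finset (ℤ × ℤ)) (hP : P.Nonempty) (c : ℝ) : ℝ :=
  P.sup' hP fun p => min (p.1 : ℝ) (p.2 + c)

theorem continuous_diagonalExit (P : Finset (ℤ × ℤ)) (hP : P.Nonempty) :
    Continuous (diagonalExit P hP) := by
  unfold diagonalExit
  refine Continuous.finset_sup'_apply hP fun p _ => ?_
  fun_prop

theorem diagonalExit_mem_shadowline (P : Finset (ℤ × ℤ)) (hP : P.Nonempty) (c : ℝ) :
    (diagonalExit P hP c, diagonalExit P hP c - c) ∈ shadowline (P : Set (ℤ × ℤ)) := by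
  rw [mem_shadowline_iff P.finite_toSet]
  constructor
  · obtain ⟨p, hp, heq⟩ := Finset.exists_mem_eq_sup' hP fun p => min (p.1 : ℝ) (p.2 + c)
    have h1 : diagonalExit P hP c ≤ p.1 := heq.trans_le (min_le_left _ _)
    have h2 : diagonalExit P hP c ≤ p.2 + c := heq.trans_le (min_le_right _ _)
    exact ⟨p, hp, h1, by simp only; linarith⟩
  · rintro p hp ⟨h1, h2⟩
    simp only at h1 h2
    have hle : min (p.1 : ℝ) (p.2 + c) ≤ diagonalExit P hP c :=
      Finset.le_sup' (fun p : ℤ × ℤ => min (p.1 : ℝ) (p.2 + c)) hp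
    exact absurd hle (not_le.2 (lt_min h1 (by linarith)))

/-- On the diagonal through `p` the region of `Q` ends no later than that of `P`; through `q` the
order is reversed. By continuity some diagonal leaves both regions at the same point. -/
theorem not_disjoint_shadowline {P Q : Set (ℤ × ℤ)} (hP : P.Finite) (hQ : Q.Finite)
    {p q : ℤ × ℤ} (hp : p ∈ P) (hq : q ∈ Q)
    (hpQ : ∀ q' ∈ Q, ¬ (p.1 < q'.1 ∧ p.2 < q'.2)) (hqP : ∀ p' ∈ P, ¬ (q.1 < p'.1 ∧ q.2 < p'.2)) :
    ¬ Disjoint (shadowline P) (shadowline Q) := by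
  have key : ∀ {A B : Finset (ℤ × ℤ)} (hA : A.Nonempty) (hB : B.Nonempty) {a : ℤ × ℤ},
      a ∈ A → (∀ b ∈ B, ¬ (a.1 < b.1 ∧ a.2 < b.2)) →
      diagonalExit B hB (a.1 - a.2) ≤ diagonalExit A hA (a.1 - a.2) := by
    intro A B hA hB a ha hab
    refine (Finset.sup'_le hB _ (a := (a.1 : ℝ)) fun b hb => ?_).trans ?_
    · rcases not_and_or.1 (hab b hb) with h | h
      · exact (min_le_left _ _).trans (Int.cast_le.2 (not_lt.1 h))
      · refine (min_le_right _ _).trans ?_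
        have : (b.2 : ℝ) ≤ a.2 := Int.cast_le.2 (not_lt.1 h)
        linarith
    · have := Finset.le_sup' (fun p : ℤ × ℤ => min (p.1 : ℝ) (p.2 + ((a.1 : ℝ) - a.2))) ha
      rwa [add_sub_cancel, min_self] at this
  lift P to Finset (ℤ × ℤ) using hP
  lift Q to Finset (ℤ × ℤ) using hQ
  have hP : P.Nonempty := ⟨p, hp⟩
  have hQ : Q.Nonempty := ⟨q, hq⟩
  obtain ⟨c, hc⟩ := intermediate_value_univ₂ (continuous_diagonalExit P hP)
    (continuous_diagonalExit Q hQ) (key hQ hP hq hqP) (key hP hQ hp hpQ)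
  refine Set.not_disjoint_iff.2 ⟨_, diagonalExit_mem_shadowline P hP c, ?_⟩
  rw [hc]
  exact diagonalExit_mem_shadowline Q hQ c

/-! ### Descending runs and the shadow diagram -/

section runs

open Classical in
/-- The number of descending runs of `σ` that end before position `i`. -/
noncomputable def runIndex {n : ℕ} (σ : Equiv.Perm (Fin n)) (i : Fin n) : ℕ :=
  (Finset.univ.filter fun e' : Fin n =>
    e' ≤ i ∧ ∃ e : Fin n, (e' : ℕ) = e + 1 ∧ σ e < σ e').card

variable {n : ℕ} (σ : Equiv.Perm (Fin n))

theorem runIndex_mono : Monotone (runIndex σ) := by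
  classical
  intro i j hij
  refine Finset.card_le_card fun e' he' => ?_
  simp only [Finset.mem_filter, Finset.mem_univ, true_and] at he' ⊢
  exact ⟨he'.1.trans hij, he'.2⟩

theorem runIndex_of_ascent {e e' : Fin n} (he : (e' : ℕ) = e + 1) (hasc : σ e < σ e') :
    runIndex σ e' = runIndex σ e + 1 := by
  classical
  rw [runIndex, runIndex, ← Finset.card_insert_of_notMem (a := e')]
  · congr 1
    ext x
    simp only [Finset.mem_filter, Finset.mem_univ, true_and, Finset.mem_insert]
    constructor
    · rintro ⟨h1, h2⟩
      rcases h1.lt_or_eq with h | h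
      · refine Or.inr ⟨?_, h2⟩
        simp only [Fin.lt_def, Fin.le_def] at *; omega
      · exact Or.inl h
    · rintro (rfl | ⟨h1, h2⟩)
      · exact ⟨le_rfl, e, he, hasc⟩
      · refine ⟨?_, h2⟩
        simp only [Fin.le_def] at *; omega
  · simp only [Finset.mem_filter, not_and]
    intro _ h
    rw [Fin.le_def] at h
    omega

theorem runIndex_of_descent {e e' : Fin n} (he : (e' : ℕ) = e + 1) (hdesc : ¬ σ e < σ e') :
    runIndex σ e' = runIndex σ e := by
  classical
  rw [runIndex, runIndex]
  congr 1
  ext x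
  simp only [Finset.mem_filter, Finset.mem_univ, true_and]
  constructor
  · rintro ⟨h1, y, hy, h2⟩
    refine ⟨?_, y, hy, h2⟩
    have hne : x ≠ e' := by
      rintro rfl
      have : y = e := Fin.ext (by omega)
      exact hdesc (this ▸ h2)
    have hlt := lt_of_le_of_ne h1 hne
    simp only [Fin.lt_def, Fin.le_def] at *; omega
  · rintro ⟨h1, h2⟩
    refine ⟨?_, h2⟩
    simp only [Fin.le_def] at *; omega

theorem runIndex_zero (h : 0 < n) : runIndex σ ⟨0, h⟩ = 0 := by
  classical
  rw [runIndex, Finset.card_eq_zero, Finset.filter_eq_empty_iff]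
  rintro x - ⟨h1, y, hy, -⟩
  rw [Fin.le_def] at h1
  simp only at h1
  omega

theorem lt_of_runIndex_eq {i j : Fin n} (hij : i < j) (h : runIndex σ i = runIndex σ j) :
    σ j < σ i := by
  refine lt_of_no_ascent σ hij fun e e' he h1 h2 hasc => ?_
  have := runIndex_of_ascent σ he hasc
  have := runIndex_mono σ h1
  have := runIndex_mono σ h2
  omega

/-- Before any position of run index larger than `k`, the run of index `k` ends at an ascent. -/
theorem exists_ascent_of_lt_runIndex {k : ℕ} {j : Fin n} (hk : k < runIndex σ j) :
    ∃ e e' : Fin n, (e' : ℕ) = e + 1 ∧ σ e < σ e' ∧ e' ≤ j ∧ runIndex σ e = k ∧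
      runIndex σ e' = k + 1 := by
  obtain ⟨j, hj⟩ := j
  induction j with
  | zero => rw [runIndex_zero] at hk; omega
  | succ m ih =>
    have hm : m < n := by omega
    by_cases hkm : k < runIndex σ ⟨m, hm⟩
    · obtain ⟨e, e', h1, h2, h3, h4⟩ := ih hm hkm
      refine ⟨e, e', h1, h2, h3.trans ?_, h4⟩
      simp [Fin.le_def]
    · by_cases hasc : σ ⟨m, hm⟩ < σ ⟨m + 1, hj⟩
      · have := runIndex_of_ascent σ (e := ⟨m, hm⟩) (e' := ⟨m + 1, hj⟩) rfl hasc
        exact ⟨⟨m, hm⟩, ⟨m + 1, hj⟩, rfl, hasc, le_rfl, by omega, by omega⟩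
      · have := runIndex_of_descent σ (e := ⟨m, hm⟩) (e' := ⟨m + 1, hj⟩) rfl hasc
        omega

/-- The point `(i, σ i)` of the permutation diagram. -/
def diagramPoint (i : Fin n) : ℤ × ℤ := (((i : ℕ) : ℤ) + 1, ((σ i : ℕ) : ℤ) + 1)

theorem diagramPoint_le_iff {i j : Fin n} :
    toPlane (diagramPoint σ i) ∈ shadow (diagramPoint σ j) ↔ i ≤ j ∧ σ i ≤ σ j := by
  simp only [toPlane, shadow, Set.mem_ofPred_eq, Int.cast_le, diagramPoint, add_le_add_iff_right,
    Nat.cast_le, Fin.le_def]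

theorem diagramPoint_lt_iff {i j : Fin n} :
    ((diagramPoint σ i).1 < (diagramPoint σ j).1 ∧ (diagramPoint σ i).2 < (diagramPoint σ j).2) ↔
      i < j ∧ σ i < σ j := by
  simp only [diagramPoint, add_lt_add_iff_right, Nat.cast_lt, Fin.lt_def]

theorem diagramPoint_injective : Function.Injective (diagramPoint σ) := by
  intro i j h
  have : (((i : ℕ) : ℤ) + 1) = ((j : ℕ) : ℤ) + 1 := congrArg Prod.fst h
  exact Fin.ext (by omega)

/-- The points of the run of index `k`. -/
def runPoints (k : ℕ) : Set (ℤ × ℤ) := diagramPoint σ '' {i | runIndex σ i = k}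

theorem finite_runPoints (k : ℕ) : (runPoints σ k).Finite := (Set.toFinite _).image _

/-! ### The shadowlines are those of the descending runs. -/

variable {σ}

theorem mem_shadowline_runPoints (i : Fin n) :
    toPlane (diagramPoint σ i) ∈ shadowline (runPoints σ (runIndex σ i)) := by
  rw [mem_shadowline_iff (finite_runPoints σ _)]
  refine ⟨⟨_, ⟨i, rfl, rfl⟩, le_rfl, le_rfl⟩, ?_⟩
  rintro _ ⟨j, hj, rfl⟩
  simp only [toPlane, Int.cast_lt]
  rw [diagramPoint_lt_iff]
  rintro ⟨h1, h2⟩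
  exact (lt_of_runIndex_eq σ h1 hj.symm).asymm h2

theorem notMem_shadowline_runPoints {i : Fin n} {k : ℕ} (h : k < runIndex σ i) :
    toPlane (diagramPoint σ i) ∉ shadowline (runPoints σ k) := by
  rw [mem_shadowline_iff (finite_runPoints σ _)]
  rintro ⟨⟨_, ⟨j, rfl, rfl⟩, hle⟩, -⟩
  exact absurd (runIndex_mono σ ((diagramPoint_le_iff σ).1 hle).1) (not_le.2 h)

/-- A point beyond run `k` has the low ascent bottom ending run `k` in its shadow. Points of run `k`
are minimal because the run decreases and the remaining points lie to its right. -/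
theorem AscentBottomsAreLow.generators_eq (h : AscentBottomsAreLow σ) (k : ℕ) :
    generators (diagramPoint σ '' {i | k ≤ runIndex σ i}) = runPoints σ k := by
  ext p
  constructor
  · rintro ⟨⟨i, hi, rfl⟩, hmin⟩
    refine ⟨i, le_antisymm (not_lt.1 fun hk => ?_) hi, rfl⟩
    obtain ⟨e, e', he, hasc, hle, hek, -⟩ := exists_ascent_of_lt_runIndex σ hk
    have hei : e < i := by simp only [Fin.lt_def, Fin.le_def] at *; omega
    exact hei.ne (diagramPoint_injective σ (hmin _ ⟨e, hek.ge, rfl⟩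
      ((diagramPoint_le_iff σ).2 ⟨hei.le, (h e e' he hasc i hei).le⟩)))
  · rintro ⟨i, rfl, rfl⟩
    refine ⟨⟨i, le_refl (runIndex σ i), rfl⟩, ?_⟩
    rintro _ ⟨j, hj, rfl⟩ hle
    rw [diagramPoint_le_iff] at hle
    rcases hle.1.lt_or_eq with hlt | rfl
    · exact absurd hle.2 (not_le.2
        (lt_of_runIndex_eq σ hlt (le_antisymm (runIndex_mono σ hle.1) hj)))
    · rfl

theorem AscentBottomsAreLow.remainingPoints_eq (h : AscentBottomsAreLow σ) (k : ℕ) :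
    remainingPoints σ k = diagramPoint σ '' {i | k ≤ runIndex σ i} := by
  induction k with
  | zero =>
    simp only [Nat.zero_le, Set.ofPred_true, Set.image_univ]
    rfl
  | succ k ih =>
    rw [remainingPoints, ih, h.generators_eq]
    ext p
    constructor
    · rintro ⟨⟨i, hi, rfl⟩, hp⟩
      have hne : k ≠ runIndex σ i := by
        rintro rfl
        exact hp (mem_shadowline_runPoints i)
      exact ⟨i, Nat.succ_le_of_lt (lt_of_le_of_ne hi hne), rfl⟩
    · rintro ⟨i, hi, rfl⟩
      exact ⟨⟨i, Nat.le_of_succ_le hi, rfl⟩, notMem_shadowline_runPoints hi⟩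

theorem AscentBottomsAreLow.nonintersecting_iff (h : AscentBottomsAreLow σ) :
    HasNonintersectingShadowDiagram σ ↔ AscentTopsAreHigh σ := by
  have hdiag : shadowDiagram σ =
      {L | ∃ k, (∃ i, k ≤ runIndex σ i) ∧ L = shadowline (runPoints σ k)} := by
    simp only [shadowDiagram, h.remainingPoints_eq, h.generators_eq, Set.image_nonempty]
    rfl
  rw [HasNonintersectingShadowDiagram, hdiag]
  constructor
  · intro hdisj e e' he hasc i hi
    have hie : i ≤ e := by simp only [Fin.lt_def, Fin.le_def] at *; omega
    have hidx := runIndex_of_ascent σ he hasc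
    have hlt : runIndex σ i < runIndex σ e' := by
      have := runIndex_mono σ hie
      omega
    by_contra hcon
    refine not_disjoint_shadowline (finite_runPoints σ (runIndex σ i))
      (finite_runPoints σ (runIndex σ e')) (p := diagramPoint σ i) (q := diagramPoint σ e')
      ⟨i, rfl, rfl⟩ ⟨e', rfl, rfl⟩ ?_ ?_
      (hdisj ⟨_, ⟨i, le_rfl⟩, rfl⟩ ⟨_, ⟨e', le_rfl⟩, rfl⟩ ?_)
    -- `e'` is the first and largest entry of its run, so nothing there exceeds `σ i`.
    · rintro _ ⟨j, hj, rfl⟩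
      rw [diagramPoint_lt_iff]
      rintro ⟨-, hσ⟩
      have hj : runIndex σ j = runIndex σ e' := hj
      rcases lt_trichotomy j e' with hje | rfl | hje
      · have : j ≤ e := by simp only [Fin.lt_def, Fin.le_def] at *; omega
        have := runIndex_mono σ this
        omega
      · exact hcon hσ
      · exact hcon (hσ.trans (lt_of_runIndex_eq σ hje hj.symm))
    · rintro _ ⟨j, hj, rfl⟩
      rw [diagramPoint_lt_iff]
      rintro ⟨hje, -⟩
      have hj : runIndex σ j = runIndex σ i := hj
      have := runIndex_mono σ hje.le
      omega
    · intro heq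
      exact notMem_shadowline_runPoints hlt (heq ▸ mem_shadowline_runPoints e')
  · intro hhigh
    have key : ∀ k l, k < l → (∃ i, l ≤ runIndex σ i) →
        Disjoint (shadowline (runPoints σ k)) (shadowline (runPoints σ l)) := by
      rintro k l hkl ⟨j, hj⟩
      refine disjoint_shadowline (finite_runPoints σ k) (finite_runPoints σ l) ?_
      rintro _ ⟨i, hi, rfl⟩
      have hi : runIndex σ i = k := hi
      -- The ascent ending run `l - 1` opens run `l`; its top dominates all earlier points.
      obtain ⟨e, e', he, hasc, -, -, he'⟩ :=
        exists_ascent_of_lt_runIndex σ (k := l - 1) (j := j) (by omega)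
      have hie : i < e' := by
        by_contra hcon
        have := runIndex_mono σ (not_lt.1 hcon)
        omega
      have hl : runIndex σ e' = l := by omega
      exact ⟨_, ⟨e', hl, rfl⟩,
        (diagramPoint_lt_iff σ).2 ⟨hie, hhigh e e' he hasc i hie⟩⟩
    rintro _ ⟨k, hk, rfl⟩ _ ⟨l, hl, rfl⟩ hne
    rcases lt_trichotomy k l with hkl | rfl | hkl
    · exact key k l hkl hl
    · exact absurd rfl hne
    · exact (key l k hkl hk).symm

theorem mem_avoidanceSet_iff (σ : Equiv.Perm (Fin n)) :
    σ ∈ avoidanceSet n {pattern3_bar1_42, pattern31_bar4_2} ↔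
      AscentBottomsAreLow σ ∧ AscentTopsAreHigh σ := by
  rw [← not_contains_pattern3_bar1_42_iff, ← not_contains_pattern31_bar4_2_iff]
  simp [avoidanceSet]

end runs

end PatienceSorting

theorem theorem3p4 (n : ℕ) :
    PatienceSorting.avoidanceSet n
        {PatienceSorting.pattern3_bar1_42, PatienceSorting.pattern31_bar4_2} =
      {σ : Equiv.Perm (Fin n) | PatienceSorting.IsReversePatienceWord σ ∧
        PatienceSorting.HasNonintersectingShadowDiagram σ} ∧
    ∀ σ ∈ PatienceSorting.avoidanceSet n
        {PatienceSorting.pattern3_bar1_42, PatienceSorting.pattern31_bar4_2},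
      (PatienceSorting.bottomRow (PatienceSorting.insertionPiles σ)).Pairwise (· < ·) ∧
      (PatienceSorting.bottomRow (PatienceSorting.recordingPiles σ)).Pairwise (· < ·) := by
  refine ⟨?_, fun σ hσ => ?_⟩
  · ext σ
    rw [PatienceSorting.mem_avoidanceSet_iff, Set.mem_ofPred_eq,
      PatienceSorting.isReversePatienceWord_iff]
    exact and_congr_right fun h => h.nonintersecting_iff.symm
  · obtain ⟨h, h'⟩ := (PatienceSorting.mem_avoidanceSet_iff σ).1 hσ
    exact ⟨h.bottomRow_insertionPiles h', h.bottomRow_recordingPiles⟩
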